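/- **Reversible Markovian process calculus.** Fix a countable set $\mathcal A$ of actions, a countably infinite set $\mathcal K$ of keys, and the set of rates $\mathbb R_{>0}$. To each prefix $\langle a,\lambda\rangle$ a backward rate $\bar\lambda\in\mathbb R_{>0}$ is assigned (it may depend on $a$ and $\lambda$). Terms are generated by $\mathbf 0$, prefix $\langle a,\lambda\rangle.R$, executed prefix $\langle a,\lambda\rangle[i].R$ ($i\in\mathcal K$), choice $R+S$, and parallel composition $R\parallel_L S$ ($L\subseteq\mathcal A$). A term is *standard* if no executed prefix occurs in it; $\mathrm{key}(R)$ is the set of keys occurring in $R$. Forward transitions $R\xrightarrow{\langle a,\lambda\rangle[i]}R'$ are the least relation such that * $\langle a,\lambda\rangle.R\xrightarrow{\langle a,\lambda\rangle[i]}\langle a,\lambda\rangle[i].R$ if $R$ is standard; * if $R\xrightarrow{\langle b,\mu\rangle[j]}R'$ and $j\ne i$, then $\langle a,\lambda\rangle[i].R\xrightarrow{\langle b,\mu\rangle[j]}\langle a,\lambda\rangle[i].R'$; * if $R\xrightarrow{\langle a,\lambda\rangle[i]}R'$ and $S$ is standard, then $R+S\xrightarrow{\langle a,\lambda\rangle[i]}R'+S$,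 and symmetrically; * if $R\xrightarrow{\langle a,\lambda\rangle[i]}R'$, $a\notin L$ and $i\notin\mathrm{key}(S)$, then $R\parallel_L S\xrightarrow{\langle a,\lambda\rangle[i]}R'\parallel_L S$, and symmetrically; * if $R\xrightarrow{\langle a,\lambda\rangle[i]}R'$, $S\xrightarrow{\langle a,\mu\rangle[i]}S'$ and $a\in L$, then $R\parallel_L S\xrightarrow{\langle a,\lambda\mu\rangle[i]}R'\parallel_L S'$. Backward transitions are the least relation such that $\langle a,\lambda\rangle[i].R$ becomes $\langle a,\lambda\rangle.R$ with label $\langle a,\bar\lambda\rangle[i]$ if $R$ is standard, and that is closed under the other four rules (read for backward transitions and backward rates; in particular, the rates of two synchronizing transitions are multiplied). A term is *reachable* if it is obtained from a standard term by finitely many forward transitions. Let $\equiv$ be the smallest equivalence relation on reachable terms that relates $R$ to the term obtained by replacing all occurrences of a key $i$ in $R$ by a key $j\notin\mathrm{key}(R)$. For a reachable $R$, the Markov chain $\mathcal M[\![R]\!]$ has as states the classes $[S]$ that can be reached from $[R]$ by forward and backward transitions (between classes, labeled by action and rate, keys being forgotten); for $s\ne s'$, $q_{s,s'}$ is the sum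 of the rates of the labels $\langle a,\lambda\rangle$ of transitions from $s$ to $s'$, and $q_{s,s}=-\sum_{s'\ne s}q_{s,s'}$. Its stationary distribution is the $\pi$ with $\pi(s)>0$ for all $s$, $\sum_s\pi(s)=1$ and $\pi Q=0$. **Corollary (product form).** Let $L\subseteq\mathcal A$ and let $R_1,R_2$ be reachable terms such that $R_1\parallel_L R_2$ is reachable. Assume that either 1. every backward rate equals the corresponding forward rate, i.e. $\bar\lambda=\lambda$ for every prefix $\langle a,\lambda\rangle$, or 2. parallel composition occurs neither in $R_1$ nor in $R_2$. Let $\mathcal S,\mathcal S_1,\mathcal S_2$ be the state spaces of $\mathcal M[\![R_1\parallel_L R_2]\!]$, $\mathcal M[\![R_1]\!]$, $\mathcal M[\![R_2]\!]$. Assume that $\mathcal S$ is the full Cartesian product $\mathcal S_1\times\mathcal S_2$, in the sense that the set of pairs $([S_1],[S_2])$ with $[S_1\parallel_L S_2]\in\mathcal S$ is $\mathcal S_1\times\mathcal S_2$. Then the three chains have unique stationary distributions $\pi,\pi_{R_1},\pi_{R_2}$, and $$\pi([S_1\parallel_L S_2])=\pi_{R_1}([S_1])\cdot\pi_{R_2}([S_2])$$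 for all $[S_1]\in\mathcal S_1$, $[S_2]\in\mathcal S_2$ and $[S_1\parallel_L S_2]\in\mathcal S$. -/

import Mathlib

namespace RMPC

/-- Rates are positive real numbers. -/
abbrev Rate : Type := {x : ℝ // 0 < x}

/-- Process terms: the terminated process, the prefix `⟨a, r⟩ . R`, the executed prefix
`⟨a, r⟩[i] . R` decorated with the key `i`, choice, and parallel composition with
synchronization set `L`. That an unexecuted prefix is only followed by a standard process is
not built into this type; it holds for all reachable processes (`Proc.Reachable`), which are
the only ones used as states. -/
inductive Proc (Act Key : Type*) where
  | nil : Proc Act Key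
  | pre (a : Act) (r : Rate) (R : Proc Act Key) : Proc Act Key
  | past (a : Act) (r : Rate) (i : Key) (R : Proc Act Key) : Proc Act Key
  | cho (R S : Proc Act Key) : Proc Act Key
  | par (R : Proc Act Key) (L : Set Act) (S : Proc Act Key) : Proc Act Key

namespace Proc

variable {Act Key : Type*}

/-- Standard forward processes: no executed prefix occurs. -/
def Std : Proc Act Key → Prop
  | nil => True
  | pre _ _ R => R.Std
  | past _ _ _ _ => False
  | cho R S => R.Std ∧ S.Std
  | par R _ S => R.Std ∧ S.Std

/-- The set of keys occurring in a process. -/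
def keys : Proc Act Key → Set Key
  | nil => ∅
  | pre _ _ R => R.keys
  | past _ _ i R => {i} ∪ R.keys
  | cho R S => R.keys ∪ S.keys
  | par R _ S => R.keys ∪ S.keys

/-- No parallel composition occurs in the process. -/
def ParFree : Proc Act Key → Prop
  | nil => True
  | pre _ _ R => R.ParFree
  | past _ _ _ R => R.ParFree
  | cho R S => R.ParFree ∧ S.ParFree
  | par _ _ _ => False

/-- Apply `f` to every key of a process. -/
def mapKeys (f : Key → Key) : Proc Act Key → Proc Act Key
  | nil => nil
  | pre a r R => pre a r (R.mapKeys f)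
  | past a r i R => past a r (f i) (R.mapKeys f)
  | cho R S => cho (R.mapKeys f) (S.mapKeys f)
  | par R L S => par (R.mapKeys f) L (S.mapKeys f)

/-- `Fwd R a r i R'`: the forward transition from `R` to `R'` labeled `⟨a, r⟩[i]`. -/
inductive Fwd : Proc Act Key → Act → Rate → Key → Proc Act Key → Prop
  | act1 {a r i R} : Std R → Fwd (pre a r R) a r i (past a r i R)
  | act2 {a r i b m j R R'} : Fwd R b m j R' → j ≠ i →
      Fwd (past a r i R) b m j (past a r i R')
  | choL {a r i R R' S} : Fwd R a r i R' → Std S → Fwd (cho R S) a r i (cho R' S)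
  | choR {a r i R S S'} : Fwd S a r i S' → Std R → Fwd (cho R S) a r i (cho R S')
  | parL {a r i R R' S} {L : Set Act} : Fwd R a r i R' → a ∉ L → i ∉ keys S →
      Fwd (par R L S) a r i (par R' L S)
  | parR {a r i R S S'} {L : Set Act} : Fwd S a r i S' → a ∉ L → i ∉ keys R →
      Fwd (par R L S) a r i (par R L S')
  | coo {a r m i R R' S S'} {L : Set Act} : Fwd R a r i R' → Fwd S a m i S' → a ∈ L →
      Fwd (par R L S) a (r * m) i (par R' L S')

/-- `Bwd back R a r i R'`: the backward transition from `R` to `R'` with action `a`, key `i`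
and (backward) rate `r`. The rate at which an executed prefix `⟨a, r⟩[i]` is undone is
`back a r`. -/
inductive Bwd (back : Act → Rate → Rate) :
    Proc Act Key → Act → Rate → Key → Proc Act Key → Prop
  | act1 {a r i R} : Std R → Bwd back (past a r i R) a (back a r) i (pre a r R)
  | act2 {a r i b m j R R'} : Bwd back R b m j R' → j ≠ i →
      Bwd back (past a r i R) b m j (past a r i R')
  | choL {a r i R R' S} : Bwd back R a r i R' → Std S → Bwd back (cho R S) a r i (cho R' S)
  | choR {a r i R S S'} : Bwd back S a r i S' → Std R → Bwd back (cho R S) a r i (cho R S')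
  | parL {a r i R R' S} {L : Set Act} : Bwd back R a r i R' → a ∉ L → i ∉ keys S →
      Bwd back (par R L S) a r i (par R' L S)
  | parR {a r i R S S'} {L : Set Act} : Bwd back S a r i S' → a ∉ L → i ∉ keys R →
      Bwd back (par R L S) a r i (par R L S')
  | coo {a r m i R R' S S'} {L : Set Act} :
      Bwd back R a r i R' → Bwd back S a m i S' → a ∈ L →
      Bwd back (par R L S) a (r * m) i (par R' L S')

/-- Reachable processes: those derivable from a standard process by finitely many forward
transitions. -/
def Reachable (R : Proc Act Key) : Prop :=
  ∃ P : Proc Act Key, P.Std ∧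
    Relation.ReflTransGen (fun S T => ∃ a r i, Fwd S a r i T) P R

open Classical in
/-- `S` is obtained from `R` by replacing one key `i`, at all of its occurrences, by a key `j`
that does not occur in `R`. (In a reachable process the occurrences of a key `i` are exactly
the executed prefixes that took part in one and the same, possibly synchronized, step.) -/
def KeyStep (R S : Proc Act Key) : Prop :=
  ∃ i j : Key, j ∉ R.keys ∧ S = R.mapKeys (Function.update id i j)

end Proc

/-- The type of reachable processes. -/
abbrev ReachableProc (Act Key : Type*) : Type _ := {R : Proc Act Key // R.Reachable}

/-- Equality up to keys: the smallest equivalence relation on reachable processes that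
contains the replacement of a key by a fresh one. -/
def keySetoid (Act Key : Type*) : Setoid (ReachableProc Act Key) :=
  Relation.EqvGen.setoid (fun R S => Proc.KeyStep R.1 S.1)

/-- Classes of reachable processes up to keys: the potential states of the Markov chains. -/
abbrev KClass (Act Key : Type*) : Type _ := Quotient (keySetoid Act Key)

variable {Act Key : Type*}

/-- The class of a reachable process. -/
def cls (R : ReachableProc Act Key) : KClass Act Key := Quotient.mk (keySetoid Act Key) R

/-- Forward transitions between classes, labeled with an action and a rate. -/
def KFwd (s : KClass Act Key) (l : Act × Rate) (s' : KClass Act Key) : Prop :=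
  ∃ (S S' : ReachableProc Act Key) (i : Key),
    cls S = s ∧ cls S' = s' ∧ Proc.Fwd S.1 l.1 l.2 i S'.1

/-- Backward transitions between classes, labeled with an action and a rate. -/
def KBwd (back : Act → Rate → Rate) (s : KClass Act Key) (l : Act × Rate)
    (s' : KClass Act Key) : Prop :=
  ∃ (S S' : ReachableProc Act Key) (i : Key),
    cls S = s ∧ cls S' = s' ∧ Proc.Bwd back S.1 l.1 l.2 i S'.1

/-- The transitions of the underlying Markov chain. -/
def KTrans (back : Act → Rate → Rate) (s : KClass Act Key) (l : Act × Rate)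
    (s' : KClass Act Key) : Prop :=
  KFwd s l s' ∨ KBwd back s l s'

/-- The state space of the Markov chain underlying `R`: all classes reachable from the initial
state, the class of `R`, by forward and backward transitions. -/
def States (back : Act → Rate → Rate) (R : ReachableProc Act Key) : Set (KClass Act Key) :=
  {s | Relation.ReflTransGen (fun u v => ∃ l, KTrans back u l v) (cls R) s}

/-- The total rate of the transitions from `s` to `s'`. -/
noncomputable def moveRate (back : Act → Rate → Rate) (s s' : KClass Act Key) : ℝ :=
  ∑' l : {l : Act × Rate // KTrans back s l s'}, (l.1.2 : ℝ)

open Classical in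
/-- The infinitesimal generator matrix of the Markov chain underlying `R`. -/
noncomputable def generator (back : Act → Rate → Rate) (R : ReachableProc Act Key) :
    Matrix (States back R) (States back R) ℝ := fun s s' =>
  if s = s' then - ∑' u : {u : States back R // u ≠ s}, moveRate back s.1 u.1.1
  else moveRate back s.1 s'.1

/-- `π` is a steady-state (stationary) distribution of the Markov chain underlying `R`: it is
positive, sums up to `1`, and satisfies the global balance equations `π Q = 0`. -/
def IsSteadyState (back : Act → Rate → Rate) (R : ReachableProc Act Key)
    (π : States back R → ℝ) : Prop :=
  (∀ s, 0 < π s) ∧ HasSum π 1 ∧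
    ∀ s', HasSum (fun s => π s * generator back R s s') 0

/-- The class `s` is the compound state `(s₁, s₂)`: it is the class of a reachable parallel
composition whose components are in the classes `s₁` and `s₂`. -/
def IsCompound (L : Set Act) (s s₁ s₂ : KClass Act Key) : Prop :=
  ∃ S S₁ S₂ : ReachableProc Act Key,
    S.1 = Proc.par S₁.1 L S₂.1 ∧ cls S = s ∧ cls S₁ = s₁ ∧ cls S₂ = s₂

end RMPC

/-! The chains are reversible. Give each state the product, over its executed prefixes, of forward
rate divided by backward rate (`invMeasure`). A forward step multiplies the product of forward rates
by its own rate, and a backward step divides the product of backward rates by its own;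
synchronization respects this because rates multiply (`Fwd.weight_eq`, `Bwd.weight_eq`). Since every
step can be undone, detailed balance follows (`invMeasure_mul_moveRate`).

Steps preserve the skeleton of a term, and up to keys a skeleton has finitely many decorations, so
state spaces are finite; they are irreducible because steps can be undone. Hence the stationary
distribution is the normalized measure (`isSteadyState_iff`).

The measure is multiplicative over parallel composition, so only the normalizing constants remain:
compound states must correspond bijectively to pairs. In general the component classes forget which
executed synchronizing actions were paired. The product hypothesis rules such actions out: each left
state must be compatible with a standard right state, which offers no partner
(`IsCompound.disjoint_clsActs_left`). Then the keys of the two sides are disjoint and can be renamed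
independently (`IsCompound.eq_of_disjoint`). -/

namespace RMPC

/-! ### Terms: skeletons, executed prefixes and weights -/

namespace Proc

variable {Act Key : Type*}

/-- The process in which all executed prefixes are reset. -/
def skeleton : Proc Act Key → Proc Act Key
  | nil => nil
  | pre a r R => pre a r R.skeleton
  | past a r _ R => pre a r R.skeleton
  | cho R S => cho R.skeleton S.skeleton
  | par R L S => par R.skeleton L S.skeleton

/-- The action-key pairs of the executed prefixes. -/
def pasts : Proc Act Key → Set (Act × Key)
  | nil => ∅
  | pre _ _ R => R.pasts
  | past a _ i R => {(a, i)} ∪ R.pasts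
  | cho R S => R.pasts ∪ S.pasts
  | par R _ S => R.pasts ∪ S.pasts

/-- The product of `c a r` over all executed prefixes `⟨a, r⟩[i]`. -/
noncomputable def weight (c : Act → Rate → Rate) : Proc Act Key → Rate
  | nil => 1
  | pre _ _ R => R.weight c
  | past a r _ R => c a r * R.weight c
  | cho R S => R.weight c * S.weight c
  | par R _ S => R.weight c * S.weight c

theorem keys_eq_image_pasts (R : Proc Act Key) : R.keys = Prod.snd '' R.pasts := by
  induction R with
  | nil => simp [keys, pasts]
  | pre a r R ih => simpa [keys, pasts] using ih
  | past a r i R ih => simp [keys, pasts, ih, Set.image_insert_eq]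
  | cho R S ih₁ ih₂ => simp [keys, pasts, ih₁, ih₂, Set.image_union]
  | par R L S ih₁ ih₂ => simp [keys, pasts, ih₁, ih₂, Set.image_union]

theorem finite_pasts (R : Proc Act Key) : R.pasts.Finite := by
  induction R with
  | nil => simp [pasts]
  | pre a r R ih => simpa [pasts] using ih
  | past a r i R ih => simpa [pasts] using ih
  | cho R S ih₁ ih₂ => exact ih₁.union ih₂
  | par R L S ih₁ ih₂ => exact ih₁.union ih₂

theorem finite_keys (R : Proc Act Key) : R.keys.Finite := by
  rw [keys_eq_image_pasts]
  exact R.finite_pasts.image _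

theorem Std.pasts_eq_empty {R : Proc Act Key} (h : R.Std) : R.pasts = ∅ := by
  induction R with
  | nil => rfl
  | pre a r R ih => exact ih h
  | past a r i R ih => exact h.elim
  | cho R S ih₁ ih₂ => simp [pasts, ih₁ h.1, ih₂ h.2]
  | par R L S ih₁ ih₂ => simp [pasts, ih₁ h.1, ih₂ h.2]

theorem Std.keys_eq_empty {R : Proc Act Key} (h : R.Std) : R.keys = ∅ := by
  rw [keys_eq_image_pasts, h.pasts_eq_empty, Set.image_empty]

/-! ### Key renaming -/

section Renaming

theorem mapKeys_congr {f g : Key → Key} {R : Proc Act Key} (h : Set.EqOn f g R.keys) :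
    R.mapKeys f = R.mapKeys g := by
  induction R with
  | nil => rfl
  | pre a r R ih => exact congrArg _ (ih h)
  | past a r i R ih =>
    simp only [mapKeys]
    rw [h (Or.inl rfl), ih fun k hk => h (Or.inr hk)]
  | cho R S ih₁ ih₂ =>
    simp only [mapKeys]
    rw [ih₁ fun k hk => h (Or.inl hk), ih₂ fun k hk => h (Or.inr hk)]
  | par R L S ih₁ ih₂ =>
    simp only [mapKeys]
    rw [ih₁ fun k hk => h (Or.inl hk), ih₂ fun k hk => h (Or.inr hk)]

theorem mapKeys_id (R : Proc Act Key) : R.mapKeys id = R := by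
  induction R <;> simp_all [mapKeys]

theorem mapKeys_mapKeys (f g : Key → Key) (R : Proc Act Key) :
    (R.mapKeys f).mapKeys g = R.mapKeys (g ∘ f) := by
  induction R <;> simp_all [mapKeys]

theorem keys_mapKeys (f : Key → Key) (R : Proc Act Key) :
    (R.mapKeys f).keys = f '' R.keys := by
  induction R <;> simp_all [mapKeys, keys, Set.image_union, Set.image_insert_eq]

theorem pasts_mapKeys (f : Key → Key) (R : Proc Act Key) :
    (R.mapKeys f).pasts = Prod.map id f '' R.pasts := by
  induction R <;> simp_all [mapKeys, pasts, Set.image_union, Set.image_insert_eq]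

theorem weight_mapKeys (c : Act → Rate → Rate) (f : Key → Key) (R : Proc Act Key) :
    (R.mapKeys f).weight c = R.weight c := by
  induction R <;> simp_all [mapKeys, weight]

theorem skeleton_mapKeys (f : Key → Key) (R : Proc Act Key) :
    (R.mapKeys f).skeleton = R.skeleton := by
  induction R <;> simp_all [mapKeys, skeleton]

theorem Std.mapKeys {R : Proc Act Key} (h : R.Std) (f : Key → Key) : (R.mapKeys f).Std := by
  induction R <;> simp_all [Proc.mapKeys, Std]

end Renaming

/-! ### Transitions of terms, reachability and finiteness -/

section Transitions

variable {back : Act → Rate → Rate} {R R' : Proc Act Key} {a : Act} {r : Rate} {i : Key}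

theorem Fwd.exists_bwd (back : Act → Rate → Rate) (h : Fwd R a r i R') :
    ∃ m, Bwd back R' a m i R := by
  induction h with
  | act1 h => exact ⟨_, .act1 h⟩
  | act2 _ hj ih => exact ih.imp fun _ h => .act2 h hj
  | choL _ hs ih => exact ih.imp fun _ h => .choL h hs
  | choR _ hs ih => exact ih.imp fun _ h => .choR h hs
  | parL _ ha hi ih => exact ih.imp fun _ h => .parL h ha hi
  | parR _ ha hi ih => exact ih.imp fun _ h => .parR h ha hi
  | coo _ _ ha ih₁ ih₂ =>
    obtain ⟨m₁, h₁⟩ := ih₁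
    obtain ⟨m₂, h₂⟩ := ih₂
    exact ⟨_, .coo h₁ h₂ ha⟩

theorem Bwd.exists_fwd (h : Bwd back R a r i R') : ∃ m, Fwd R' a m i R := by
  induction h with
  | act1 h => exact ⟨_, .act1 h⟩
  | act2 _ hj ih => exact ih.imp fun _ h => .act2 h hj
  | choL _ hs ih => exact ih.imp fun _ h => .choL h hs
  | choR _ hs ih => exact ih.imp fun _ h => .choR h hs
  | parL _ ha hi ih => exact ih.imp fun _ h => .parL h ha hi
  | parR _ ha hi ih => exact ih.imp fun _ h => .parR h ha hi
  | coo _ _ ha ih₁ ih₂ =>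
    obtain ⟨m₁, h₁⟩ := ih₁
    obtain ⟨m₂, h₂⟩ := ih₂
    exact ⟨_, .coo h₁ h₂ ha⟩

/-- A step of one component changes one factor of the product. In a synchronization both factors
change, and the rate of the label is the product of the two rates. -/
theorem Fwd.weight_eq (h : Fwd R a r i R') :
    R'.weight (fun _ m => m) = r * R.weight (fun _ m => m) := by
  induction h with
  | act1 _ => rfl
  | act2 _ _ ih => simp only [weight, ih, mul_left_comm]
  | choL _ _ ih => simp only [weight, ih, mul_assoc]
  | choR _ _ ih => simp only [weight, ih, mul_left_comm]
  | parL _ _ _ ih => simp only [weight, ih, mul_assoc]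
  | parR _ _ _ ih => simp only [weight, ih, mul_left_comm]
  | coo _ _ _ ih₁ ih₂ => simp only [weight, ih₁, ih₂, mul_mul_mul_comm]

theorem Bwd.weight_eq (h : Bwd back R a r i R') : R.weight back = r * R'.weight back := by
  induction h with
  | act1 _ => rfl
  | act2 _ _ ih => simp only [weight, ih, mul_left_comm]
  | choL _ _ ih => simp only [weight, ih, mul_assoc]
  | choR _ _ ih => simp only [weight, ih, mul_left_comm]
  | parL _ _ _ ih => simp only [weight, ih, mul_assoc]
  | parR _ _ _ ih => simp only [weight, ih, mul_left_comm]
  | coo _ _ _ ih₁ ih₂ => simp only [weight, ih₁, ih₂, mul_mul_mul_comm]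

theorem Fwd.skeleton_eq (h : Fwd R a r i R') : R'.skeleton = R.skeleton := by
  induction h <;> simp_all [skeleton]

theorem Fwd.pasts_eq (h : Fwd R a r i R') : R'.pasts = insert (a, i) R.pasts := by
  induction h with
  | act1 _ => simp [pasts]
  | act2 _ _ ih => simp [pasts, ih, Set.insert_comm]
  | choL _ _ ih => simp [pasts, ih, Set.insert_union]
  | choR _ _ ih => simp [pasts, ih, Set.union_insert]
  | parL _ _ _ ih => simp [pasts, ih, Set.insert_union]
  | parR _ _ _ ih => simp [pasts, ih, Set.union_insert]
  | coo _ _ _ ih₁ ih₂ => simp [pasts, ih₁, ih₂, Set.insert_union, Set.union_insert]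

theorem Fwd.keys_eq (h : Fwd R a r i R') : R'.keys = insert i R.keys := by
  rw [keys_eq_image_pasts, keys_eq_image_pasts, h.pasts_eq, Set.image_insert_eq]

/-- The keys of the target include the new key, so injectivity there preserves the side conditions
on key freshness. -/
theorem Fwd.mapKeys (h : Fwd R a r i R') {f : Key → Key} (hf : Set.InjOn f R'.keys) :
    Fwd (R.mapKeys f) a r (f i) (R'.mapKeys f) := by
  induction h with
  | act1 h => exact .act1 (h.mapKeys f)
  | act2 h hj ih =>
    refine .act2 (ih (hf.mono Set.subset_union_right)) fun e => hj (hf ?_ (Or.inl rfl) e)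
    exact Or.inr (h.keys_eq ▸ Set.mem_insert _ _)
  | choL _ hs ih => exact .choL (ih (hf.mono Set.subset_union_left)) (hs.mapKeys f)
  | choR _ hs ih => exact .choR (ih (hf.mono Set.subset_union_right)) (hs.mapKeys f)
  | parL h ha hi ih =>
    refine .parL (ih (hf.mono Set.subset_union_left)) ha ?_
    rw [keys_mapKeys]
    rintro ⟨k, hk, e⟩
    exact hi (hf (Or.inr hk) (Or.inl (h.keys_eq ▸ Set.mem_insert _ _)) e ▸ hk)
  | parR h ha hi ih =>
    refine .parR (ih (hf.mono Set.subset_union_right)) ha ?_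
    rw [keys_mapKeys]
    rintro ⟨k, hk, e⟩
    exact hi (hf (Or.inl hk) (Or.inr (h.keys_eq ▸ Set.mem_insert _ _)) e ▸ hk)
  | coo _ _ ha ih₁ ih₂ =>
    exact .coo (ih₁ (hf.mono Set.subset_union_left)) (ih₂ (hf.mono Set.subset_union_right)) ha

theorem Reachable.fwd (hR : R.Reachable) (h : Fwd R a r i R') : R'.Reachable := by
  obtain ⟨P, hP, hPR⟩ := hR
  exact ⟨P, hP, hPR.tail ⟨a, r, i, h⟩⟩

theorem Reachable.mapKeys (hR : R.Reachable) {f : Key → Key} (hf : Set.InjOn f R.keys) :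
    (R.mapKeys f).Reachable := by
  obtain ⟨P, hP, hPR⟩ := hR
  induction hPR with
  | refl => exact ⟨_, hP.mapKeys f, .refl⟩
  | tail _ h ih =>
    obtain ⟨a, r, i, h⟩ := h
    exact (ih (hf.mono (h.keys_eq ▸ Set.subset_insert _ _))).fwd (h.mapKeys hf)

/-- In a reachable parallel composition the components are reachable, executed synchronizing
actions occur on both sides with the same keys, and only their keys are shared. -/
theorem Reachable.par_inv {S : Proc Act Key} {L : Set Act} (h : (par R L S).Reachable) :
    R.Reachable ∧ S.Reachable ∧ (∀ a ∈ L, ∀ i, (a, i) ∈ R.pasts ↔ (a, i) ∈ S.pasts) ∧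
      ∀ i ∈ R.keys, i ∈ S.keys → ∃ a ∈ L, (a, i) ∈ R.pasts := by
  obtain ⟨P, hP, hPT⟩ := h
  generalize hT : par R L S = T at hPT
  induction hPT generalizing R S with
  | refl =>
    subst hT
    refine ⟨⟨R, hP.1, .refl⟩, ⟨S, hP.2, .refl⟩, ?_, ?_⟩
    · simp [hP.1.pasts_eq_empty, hP.2.pasts_eq_empty]
    · simp [hP.1.keys_eq_empty]
  | tail _ h ih =>
    obtain ⟨a, r, i, h⟩ := h
    subst hT
    cases h with
    | parL h ha hi =>
      obtain ⟨h₁, h₂, h₃, h₄⟩ := ih rfl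
      refine ⟨h₁.fwd h, h₂, fun b hb k => ?_, fun k hk hk' => ?_⟩
      · rw [h.pasts_eq, ← h₃ b hb k, Set.mem_insert_iff, or_iff_right]
        rintro ⟨⟩
        exact ha hb
      · rw [h.keys_eq] at hk
        rw [h.pasts_eq]
        rcases hk with rfl | hk
        · exact (hi hk').elim
        · obtain ⟨b, hb, hbk⟩ := h₄ k hk hk'
          exact ⟨b, hb, Or.inr hbk⟩
    | parR h ha hi =>
      obtain ⟨h₁, h₂, h₃, h₄⟩ := ih rfl
      refine ⟨h₁, h₂.fwd h, fun b hb k => ?_, fun k hk hk' => ?_⟩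
      · rw [h.pasts_eq, h₃ b hb k, Set.mem_insert_iff, or_iff_right]
        rintro ⟨⟩
        exact ha hb
      · rw [h.keys_eq] at hk'
        rcases hk' with rfl | hk'
        · exact (hi hk).elim
        · exact h₄ k hk hk'
    | coo h h' ha =>
      obtain ⟨h₁, h₂, h₃, h₄⟩ := ih rfl
      refine ⟨h₁.fwd h, h₂.fwd h', fun b hb k => ?_, fun k hk hk' => ?_⟩
      · rw [h.pasts_eq, h'.pasts_eq, Set.mem_insert_iff, Set.mem_insert_iff, h₃ b hb k]
      · rw [h.keys_eq] at hk
        rw [h'.keys_eq] at hk'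
        rw [h.pasts_eq]
        rcases hk with rfl | hk
        · exact ⟨_, ha, Or.inl rfl⟩
        rcases hk' with rfl | hk'
        · exact ⟨_, ha, Or.inl rfl⟩
        · obtain ⟨b, hb, hbk⟩ := h₄ k hk hk'
          exact ⟨b, hb, Or.inr hbk⟩

/-- Only finitely many processes have a given skeleton and keys from a given finite set. -/
theorem finite_skeleton_eq (P : Proc Act Key) {K : Set Key} (hK : K.Finite) :
    {R : Proc Act Key | R.skeleton = P ∧ R.keys ⊆ K}.Finite := by
  induction P with
  | nil =>
    refine (Set.finite_singleton nil).subset ?_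
    rintro (_ | _ | _ | _ | _) ⟨h, -⟩ <;> simp_all [skeleton]
  | pre a r P ih =>
    refine ((ih.image (pre a r)).union
      ((hK.prod ih).image fun p => past a r p.1 p.2)).subset ?_
    rintro (_ | ⟨b, m, R⟩ | ⟨b, m, i, R⟩ | _ | _) ⟨h, h'⟩ <;> simp [skeleton] at h
    · obtain ⟨rfl, rfl, h⟩ := h
      exact Or.inl ⟨R, ⟨h, h'⟩, rfl⟩
    · obtain ⟨rfl, rfl, h⟩ := h
      exact Or.inr ⟨(i, R), ⟨h' (Or.inl rfl), h, fun k hk => h' (Or.inr hk)⟩, rfl⟩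
  | past a r i P ih =>
    -- A skeleton never contains an executed prefix.
    refine Set.finite_empty.subset ?_
    rintro (_ | _ | _ | _ | _) ⟨h, -⟩ <;> simp_all [skeleton]
  | cho P Q ih₁ ih₂ =>
    refine ((ih₁.prod ih₂).image fun p => cho p.1 p.2).subset ?_
    rintro (_ | _ | _ | ⟨R, S⟩ | _) ⟨h, h'⟩ <;> simp [skeleton] at h
    exact ⟨(R, S), ⟨⟨h.1, fun k hk => h' (Or.inl hk)⟩, h.2, fun k hk => h' (Or.inr hk)⟩, rfl⟩
  | par P L Q ih₁ ih₂ =>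
    refine ((ih₁.prod ih₂).image fun p => par p.1 L p.2).subset ?_
    rintro (_ | _ | _ | _ | ⟨R, L', S⟩) ⟨h, h'⟩ <;> simp [skeleton] at h
    obtain ⟨h₁, rfl, h₂⟩ := h
    exact ⟨(R, S), ⟨⟨h₁, fun k hk => h' (Or.inl hk)⟩, h₂, fun k hk => h' (Or.inr hk)⟩, rfl⟩

/-- The number of executed and unexecuted prefixes. -/
def numPrefixes : Proc Act Key → ℕ
  | nil => 0
  | pre _ _ R => R.numPrefixes + 1
  | past _ _ _ R => R.numPrefixes + 1
  | cho R S => R.numPrefixes + S.numPrefixes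
  | par R _ S => R.numPrefixes + S.numPrefixes

theorem numPrefixes_skeleton (R : Proc Act Key) : R.skeleton.numPrefixes = R.numPrefixes := by
  induction R <;> simp_all [skeleton, numPrefixes]

theorem ncard_keys_le (R : Proc Act Key) : R.keys.ncard ≤ R.numPrefixes := by
  induction R with
  | nil => simp [keys]
  | pre a r R ih => exact ih.trans (Nat.le_succ _)
  | past a r i R ih =>
    refine (Set.ncard_union_le _ _).trans ?_
    simp only [Set.ncard_singleton, numPrefixes]
    omega
  | cho R S ih₁ ih₂ => exact (Set.ncard_union_le _ _).trans (add_le_add ih₁ ih₂)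
  | par R L S ih₁ ih₂ => exact (Set.ncard_union_le _ _).trans (add_le_add ih₁ ih₂)

end Transitions

end Proc

end RMPC
namespace RMPC

variable {Act Key : Type*}

/-! ### Classes up to keys and their invariants -/

section Classes

open Proc

/-- When the new keys avoid all the old ones, the keys can be replaced one at a time without
collisions. -/
theorem cls_mapKeys_of_disjoint {R : ReachableProc Act Key} {f : Key → Key}
    (hf : Set.InjOn f R.1.keys) (hd : Disjoint (f '' R.1.keys) R.1.keys) :
    cls (⟨R.1.mapKeys f, R.2.mapKeys hf⟩ : ReachableProc Act Key) = cls R := by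
  classical
  have hd' : ∀ i ∈ R.1.keys, f i ∉ R.1.keys := fun i hi h =>
    Set.disjoint_left.1 hd ⟨i, hi, rfl⟩ h
  have inj : ∀ A : Set Key, A ⊆ R.1.keys → Set.InjOn (A.piecewise f id) R.1.keys := by
    intro A hA i hi j hj h
    by_cases hiA : i ∈ A <;> by_cases hjA : j ∈ A <;>
      simp only [Set.piecewise, hiA, hjA, if_true, if_false, id] at h
    · exact hf hi hj h
    · exact (hd' i hi (h ▸ hj)).elim
    · exact (hd' j hj (h ▸ hi)).elim
    · exact h
  -- `A` is the set of keys already replaced.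
  have key : ∀ A : Set Key, A.Finite → ∀ hA : A ⊆ R.1.keys,
      cls (⟨R.1.mapKeys (A.piecewise f id), R.2.mapKeys (inj A hA)⟩ : ReachableProc Act Key) =
        cls R := by
    intro A hfin
    induction A, hfin using Set.Finite.induction_on with
    | empty =>
      intro hA
      simp only [Set.piecewise_empty, mapKeys_id]
    | @insert i A hi _ ih =>
      intro hA
      have hAR : A ⊆ R.1.keys := (Set.subset_insert _ _).trans hA
      have hiR : i ∈ R.1.keys := hA (Set.mem_insert _ _)
      rw [← ih hAR]
      -- The key `f i` is fresh: injectivity separates it from the keys already replaced,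
      -- disjointness from the untouched ones.
      refine (Quotient.sound (Relation.EqvGen.rel _ _ ⟨i, f i, ?_, ?_⟩)).symm
      · rw [keys_mapKeys]
        rintro ⟨j, hj, h⟩
        by_cases hjA : j ∈ A <;>
          simp only [Set.piecewise, hjA, if_true, if_false, id] at h
        · exact hi (hf hj hiR h ▸ hjA)
        · exact hd' i hiR (h ▸ hj)
      · simp only [mapKeys_mapKeys]
        refine mapKeys_congr fun j hj => ?_
        rcases eq_or_ne j i with rfl | hji
        · simp [Set.piecewise, hi]
        · by_cases hjA : j ∈ A
          · have : f j ≠ i := fun h => hd' j hj (h ▸ hiR)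
            simp [Set.piecewise, hjA, this]
          · simp [Set.piecewise, hjA, hji]
  have h := key _ R.1.finite_keys subset_rfl
  rw [← h]
  congr 2
  exact mapKeys_congr fun i hi => by simp [Set.piecewise, hi]

/-- Renaming the keys of a reachable process injectively does not change its class. -/
theorem cls_mapKeys [Infinite Key] {R : ReachableProc Act Key} {f : Key → Key}
    (hf : Set.InjOn f R.1.keys) :
    cls (⟨R.1.mapKeys f, R.2.mapKeys hf⟩ : ReachableProc Act Key) = cls R := by
  have hfin : (R.1.keys ∪ f '' R.1.keys).Finite :=
    R.1.finite_keys.union (R.1.finite_keys.image f)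
  -- An arbitrary renaming, for instance a swap, may collide midway. The detour through `g`, whose
  -- values avoid both old and new keys, reduces it to two disjoint renamings.
  obtain ⟨g, hg, hgi⟩ := R.1.finite_keys.exists_injOn_of_encard_le
    (t := (R.1.keys ∪ f '' R.1.keys)ᶜ) (by
      rw [hfin.infinite_compl.encard_eq]
      exact le_top)
  have hg' : Disjoint (g '' R.1.keys) (R.1.keys ∪ f '' R.1.keys) := by
    rw [Set.disjoint_left]
    rintro _ ⟨i, hi, rfl⟩
    exact hg hi
  have : Nonempty Key := inferInstance
  have hinv : Set.LeftInvOn (Function.invFunOn f R.1.keys) f R.1.keys := hf.leftInvOn_invFunOn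
  have hcomp : Set.EqOn ((g ∘ Function.invFunOn f R.1.keys) ∘ f) g R.1.keys := fun i hi =>
    congrArg g (hinv hi)
  have himg : (g ∘ Function.invFunOn f R.1.keys) '' (f '' R.1.keys) = g '' R.1.keys := by
    rw [← Set.image_comp, hcomp.image_eq]
  set T : ReachableProc Act Key := ⟨R.1.mapKeys f, R.2.mapKeys hf⟩ with hT
  have hk : T.1.keys = f '' R.1.keys := keys_mapKeys _ _
  have h₁ := cls_mapKeys_of_disjoint (R := R) hgi (hg'.mono_right Set.subset_union_left)
  have hinj : Set.InjOn (g ∘ Function.invFunOn f R.1.keys) T.1.keys := by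
    rw [hk]
    rintro _ ⟨i, hi, rfl⟩ _ ⟨j, hj, rfl⟩ h
    rw [hgi hi hj ((hcomp hi).symm.trans (h.trans (hcomp hj)))]
  have h₂ := cls_mapKeys_of_disjoint (R := T) hinj
    (by rw [hk, himg]; exact hg'.mono_right Set.subset_union_right)
  rw [← h₂, ← h₁]
  congr 2
  rw [hT]
  simp only [mapKeys_mapKeys]
  exact mapKeys_congr hcomp

theorem exists_perm_of_cls_eq {R S : ReachableProc Act Key} (h : cls R = cls S) :
    ∃ σ : Equiv.Perm Key, S.1 = R.1.mapKeys σ := by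
  classical
  replace h : Relation.EqvGen (fun R S : ReachableProc Act Key => KeyStep R.1 S.1) R S :=
    Quotient.exact h
  induction h with
  | rel R S h =>
    obtain ⟨i, j, hj, h⟩ := h
    refine ⟨Equiv.swap i j, ?_⟩
    convert h.trans (mapKeys_congr fun k hk => ?_) using 1
    rcases eq_or_ne k i with rfl | hki
    · simp
    · have : k ≠ j := fun h => hj (h ▸ hk)
      simp [hki, Equiv.swap_apply_of_ne_of_ne hki this]
  | refl R => exact ⟨1, (mapKeys_id _).symm⟩
  | symm R S _ ih =>
    obtain ⟨σ, h⟩ := ih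
    refine ⟨σ.symm, ?_⟩
    rw [h, mapKeys_mapKeys, Equiv.symm_comp_self, mapKeys_id]
  | trans R S T _ _ ih₁ ih₂ =>
    obtain ⟨σ, h₁⟩ := ih₁
    obtain ⟨τ, h₂⟩ := ih₂
    exact ⟨σ.trans τ, by rw [h₂, h₁, mapKeys_mapKeys]; rfl⟩

theorem cls_surjective (s : KClass Act Key) : ∃ S : ReachableProc Act Key, cls S = s :=
  Quotient.exists_rep s

/-- The product of `c a r` over the executed prefixes of a class. -/
noncomputable def clsWeight (c : Act → Rate → Rate) (s : KClass Act Key) : Rate :=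
  (cls_surjective s).choose.1.weight c

theorem clsWeight_cls (c : Act → Rate → Rate) (S : ReachableProc Act Key) :
    clsWeight c (cls S) = S.1.weight c := by
  obtain ⟨σ, h⟩ := exists_perm_of_cls_eq (cls_surjective (cls S)).choose_spec
  rw [h, weight_mapKeys]
  rfl

/-- The skeleton shared by the processes of a class. -/
noncomputable def clsSkeleton (s : KClass Act Key) : Proc Act Key :=
  (cls_surjective s).choose.1.skeleton

theorem clsSkeleton_cls (S : ReachableProc Act Key) : clsSkeleton (cls S) = S.1.skeleton := by
  obtain ⟨σ, h⟩ := exists_perm_of_cls_eq (cls_surjective (cls S)).choose_spec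
  rw [h, skeleton_mapKeys]
  rfl

/-- The actions of the executed prefixes of a class. -/
def clsActs (s : KClass Act Key) : Set Act :=
  Prod.fst '' (cls_surjective s).choose.1.pasts

theorem clsActs_cls (S : ReachableProc Act Key) : clsActs (cls S) = Prod.fst '' S.1.pasts := by
  obtain ⟨σ, h⟩ := exists_perm_of_cls_eq (cls_surjective (cls S)).choose_spec
  rw [h, pasts_mapKeys, ← Set.image_comp]
  rfl

theorem finite_clsActs (s : KClass Act Key) : (clsActs s).Finite :=
  (finite_pasts _).image _

theorem finite_clsSkeleton_eq [Infinite Key] (P : Proc Act Key) :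
    {s : KClass Act Key | clsSkeleton s = P}.Finite := by
  -- A term has at most as many keys as prefixes, so every class has a representative with keys in
  -- `K`.
  obtain ⟨K, hK⟩ := Infinite.exists_subset_card_eq Key P.numPrefixes
  refine ((finite_skeleton_eq P K.finite_toSet).preimage
    (f := fun S : ReachableProc Act Key => S.1) Subtype.val_injective.injOn |>.image cls).subset ?_
  intro s hs
  obtain ⟨S, rfl⟩ := cls_surjective s
  have hs : S.1.skeleton = P := (clsSkeleton_cls S).symm.trans hs
  obtain ⟨f, hf, hfi⟩ := S.1.finite_keys.exists_injOn_of_encard_le (t := (K : Set Key)) (by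
    rw [← S.1.finite_keys.cast_ncard_eq, Set.encard_coe_eq_coe_finsetCard, hK, ← hs,
      numPrefixes_skeleton]
    exact_mod_cast S.1.ncard_keys_le)
  refine ⟨⟨S.1.mapKeys f, S.2.mapKeys hfi⟩, ⟨?_, ?_⟩, cls_mapKeys hfi⟩
  · exact (skeleton_mapKeys _ _).trans hs
  · change (S.1.mapKeys f).keys ⊆ _
    rw [keys_mapKeys, Set.image_subset_iff]
    exact hf

end Classes

/-! ### Detailed balance between classes -/

section Transitions

variable {back : Act → Rate → Rate} {s s' : KClass Act Key} {a : Act} {r : Rate}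

/-- The invariant measure: the product of the ratios of forward and backward rates over the
executed prefixes. -/
noncomputable def invMeasure (back : Act → Rate → Rate) (s : KClass Act Key) : Rate :=
  clsWeight (fun _ r => r) s / clsWeight back s

theorem KFwd.weight_eq (h : KFwd s (a, r) s') :
    clsWeight (fun _ r => r) s' = r * clsWeight (fun _ r => r) s := by
  obtain ⟨S, S', i, rfl, rfl, h⟩ := h
  rw [clsWeight_cls, clsWeight_cls]
  exact h.weight_eq

theorem KBwd.weight_eq (h : KBwd back s (a, r) s') :
    clsWeight back s = r * clsWeight back s' := by
  obtain ⟨S, S', i, rfl, rfl, h⟩ := h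
  rw [clsWeight_cls, clsWeight_cls]
  exact h.weight_eq

/-- The rate of the undoing step is forced: both rates are quotients of the weights of the two
classes. -/
theorem KFwd.reverse (h : KFwd s (a, r) s') :
    KBwd back s' (a, r * (invMeasure back s / invMeasure back s')) s := by
  have hw := h.weight_eq
  obtain ⟨S, S', i, hs, hs', h⟩ := h
  obtain ⟨m, hb⟩ := h.exists_bwd back
  have hb' : KBwd back s' (a, m) s := ⟨S', S, i, hs', hs, hb⟩
  have hw' := hb'.weight_eq
  convert hb' using 2
  rw [invMeasure, invMeasure, hw, hw']
  generalize clsWeight (fun _ r => r) s = x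
  generalize clsWeight back s = y
  have hx := x.2.ne'
  have hy := y.2.ne'
  have hr := r.2.ne'
  have hm := m.2.ne'
  apply Subtype.ext
  simp only [div_eq_mul_inv, Positive.val_mul, Positive.coe_inv]
  field_simp

theorem KBwd.reverse (h : KBwd back s (a, r) s') :
    KFwd s' (a, r * (invMeasure back s / invMeasure back s')) s := by
  have hw := h.weight_eq
  obtain ⟨S, S', i, hs, hs', h⟩ := h
  obtain ⟨m, hb⟩ := h.exists_fwd
  have hb' : KFwd s' (a, m) s := ⟨S', S, i, hs', hs, hb⟩
  have hw' := hb'.weight_eq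
  convert hb' using 2
  rw [invMeasure, invMeasure, hw, hw']
  generalize clsWeight (fun _ r => r) s' = x
  generalize clsWeight back s' = y
  have hx := x.2.ne'
  have hy := y.2.ne'
  have hr := r.2.ne'
  have hm := m.2.ne'
  apply Subtype.ext
  simp only [div_eq_mul_inv, Positive.val_mul, Positive.coe_inv]
  field_simp

theorem KTrans.reverse (h : KTrans back s (a, r) s') :
    KTrans back s' (a, r * (invMeasure back s / invMeasure back s')) s :=
  h.symm.imp KBwd.reverse KFwd.reverse

theorem KTrans.exists_reverse {l : Act × Rate} (h : KTrans back s l s') :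
    ∃ l, KTrans back s' l s :=
  ⟨_, h.reverse⟩

/-- Detailed balance. -/
theorem invMeasure_mul_moveRate (back : Act → Rate → Rate) (s s' : KClass Act Key) :
    (invMeasure back s : ℝ) * moveRate back s s' = invMeasure back s' * moveRate back s' s := by
  have hc (s s' : KClass Act Key) (r : Rate) :
      r * (invMeasure back s / invMeasure back s') * (invMeasure back s' / invMeasure back s) =
        r := by
    rw [mul_assoc, div_mul_div_cancel, div_self', mul_one]
  -- Labels form a set, so rates are compared through a bijection of labels: rescaling by the ratio
  -- of measures reverses a transition.
  let e : {l : Act × Rate // KTrans back s l s'} ≃ {l : Act × Rate // KTrans back s' l s} :=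
    { toFun := fun l => ⟨(l.1.1, l.1.2 * (invMeasure back s / invMeasure back s')), l.2.reverse⟩
      invFun := fun l => ⟨(l.1.1, l.1.2 * (invMeasure back s' / invMeasure back s)), l.2.reverse⟩
      left_inv := fun l => Subtype.ext (Prod.ext rfl (hc s s' l.1.2))
      right_inv := fun l => Subtype.ext (Prod.ext rfl (hc s' s l.1.2)) }
  have hpos := (invMeasure back s').2.ne'
  rw [moveRate, moveRate, ← e.tsum_eq, ← tsum_mul_left, ← tsum_mul_left]
  refine tsum_congr fun l => ?_
  simp only [e, Equiv.coe_fn_mk, Positive.val_mul, div_eq_mul_inv, Positive.coe_inv]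
  field_simp

theorem KTrans.skeleton_eq {l : Act × Rate} (h : KTrans back s l s') :
    clsSkeleton s' = clsSkeleton s := by
  rcases h with ⟨S, S', i, rfl, rfl, h⟩ | ⟨S, S', i, rfl, rfl, h⟩ <;>
    rw [clsSkeleton_cls, clsSkeleton_cls]
  · exact h.skeleton_eq
  · exact h.exists_fwd.choose_spec.skeleton_eq.symm

theorem KFwd.mem_clsActs (h : KFwd s (a, r) s') : a ∈ clsActs s' := by
  obtain ⟨S, S', i, rfl, rfl, h⟩ := h
  rw [clsActs_cls, h.pasts_eq]
  exact ⟨(a, i), Or.inl rfl, rfl⟩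

theorem KBwd.mem_clsActs (h : KBwd back s (a, r) s') : a ∈ clsActs s :=
  (KBwd.reverse h).mem_clsActs

/-- The two classes determine the rate through their weights, once for each direction; only the
action can vary, among the executed ones. Finiteness makes the `tsum` in `moveRate` a genuine sum,
not the default `0`. -/
theorem finite_labels (back : Act → Rate → Rate) (s s' : KClass Act Key) :
    {l : Act × Rate | KTrans back s l s'}.Finite := by
  refine (((finite_clsActs s').prod (Set.finite_singleton
    (clsWeight (fun _ r => r) s' / clsWeight (fun _ r => r) s))).union
    ((finite_clsActs s).prod (Set.finite_singleton
    (clsWeight back s / clsWeight back s')))).subset ?_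
  rintro ⟨a, r⟩ (h | h)
  · exact Or.inl ⟨h.mem_clsActs, eq_div_of_mul_eq' h.weight_eq.symm⟩
  · exact Or.inr ⟨h.mem_clsActs, eq_div_of_mul_eq' h.weight_eq.symm⟩

theorem moveRate_nonneg (back : Act → Rate → Rate) (s s' : KClass Act Key) :
    0 ≤ moveRate back s s' :=
  tsum_nonneg fun l => l.1.2.2.le

theorem KTrans.moveRate_pos {l : Act × Rate} (h : KTrans back s l s') :
    0 < moveRate back s s' := by
  have : Finite {l : Act × Rate // KTrans back s l s'} := finite_labels back s s'
  exact Summable.tsum_pos Summable.of_finite (fun l => l.1.2.2.le) ⟨l, h⟩ l.2.2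

end Transitions

end RMPC
namespace RMPC

variable {Act Key : Type*}

/-! ### Existence and uniqueness of the stationary distribution -/

section SteadyState

variable {back : Act → Rate → Rate} {R : ReachableProc Act Key}

theorem clsSkeleton_of_mem_states {s : KClass Act Key} (h : s ∈ States back R) :
    clsSkeleton s = R.1.skeleton := by
  rw [← clsSkeleton_cls]
  induction h with
  | refl => rfl
  | tail _ h ih => exact h.choose_spec.skeleton_eq.trans ih

theorem finite_states [Infinite Key] (back : Act → Rate → Rate) (R : ReachableProc Act Key) :
    (States back R).Finite :=
  (finite_clsSkeleton_eq R.1.skeleton).subset fun _ h => clsSkeleton_of_mem_states h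

theorem reflTransGen_ktrans_symm {s t : KClass Act Key}
    (h : Relation.ReflTransGen (fun u v => ∃ l, KTrans back u l v) s t) :
    Relation.ReflTransGen (fun u v => ∃ l, KTrans back u l v) t s := by
  induction h with
  | refl => exact .refl
  | tail _ h ih => exact .head h.choose_spec.exists_reverse ih

theorem reflTransGen_of_mem_states {s t : KClass Act Key} (hs : s ∈ States back R)
    (ht : t ∈ States back R) :
    Relation.ReflTransGen (fun u v => ∃ l, KTrans back u l v) s t :=
  (reflTransGen_ktrans_symm hs).trans ht

/-- The diagonal entry collects the outflow, which turns global balance into vanishing net flux. -/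
theorem sum_mul_generator [Fintype (States back R)] (π : States back R → ℝ)
    (s' : States back R) :
    ∑ s, π s * generator back R s s' =
      ∑ s, (π s * moveRate back s.1 s'.1 - π s' * moveRate back s'.1 s.1) := by
  classical
  have hout : ∑' u : {u : States back R // u ≠ s'}, moveRate back s'.1 u.1.1 =
      ∑ u ∈ Finset.univ.erase s', moveRate back s'.1 u.1 := by
    rw [tsum_fintype]
    exact (Finset.sum_subtype _ (by simp) (fun u : States back R => moveRate back s'.1 u.1)).symm
  rw [← Finset.add_sum_erase _ _ (Finset.mem_univ s'),
    ← Finset.add_sum_erase _ (fun s => _ - _) (Finset.mem_univ s'), sub_self, zero_add,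
    Finset.sum_sub_distrib, ← Finset.mul_sum, ← hout]
  have hin : ∑ s ∈ Finset.univ.erase s', π s * generator back R s s' =
      ∑ s ∈ Finset.univ.erase s', π s * moveRate back s.1 s'.1 :=
    Finset.sum_congr rfl fun s hs => by
      rw [generator, if_neg (Finset.ne_of_mem_erase hs)]
  rw [hin, generator, if_pos rfl]
  ring

/-- A solution of the global balance equations is a multiple of the invariant measure. -/
theorem exists_eq_mul_invMeasure [Fintype (States back R)] {π : States back R → ℝ}
    (hπ : ∀ s', ∑ s, π s * generator back R s s' = 0) :
    ∃ c : ℝ, ∀ s, π s = c * invMeasure back s.1 := by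
  have : Nonempty (States back R) := ⟨⟨cls R, .refl⟩⟩
  let g : States back R → ℝ := fun s => π s / invMeasure back s.1
  have hg (s : States back R) : π s = g s * invMeasure back s.1 :=
    (div_mul_cancel₀ _ (invMeasure back s.1).2.ne').symm
  -- Maximum principle: by detailed balance, global balance says that a weighted sum of the
  -- differences of `g` vanishes, so a maximum of `g` spreads to all neighbours and, by
  -- irreducibility, everywhere.
  obtain ⟨s₀, hs₀⟩ := Finite.exists_max g
  have hstep : ∀ s t : States back R, g s = g s₀ → (∃ l, KTrans back s.1 l t.1) →
      g t = g s₀ := by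
    rintro s t hs ⟨l, hl⟩
    have hsum := hπ s
    rw [sum_mul_generator] at hsum
    have hterm (u : States back R) :
        π u * moveRate back u.1 s.1 - π s * moveRate back s.1 u.1 =
          invMeasure back s.1 * moveRate back s.1 u.1 * (g u - g s₀) := by
      rw [hg u, hg s, hs, mul_assoc, invMeasure_mul_moveRate]
      ring
    simp only [hterm] at hsum
    have hle : ∀ u ∈ Finset.univ, (invMeasure back s.1 : ℝ) * moveRate back s.1 u.1 *
        (g u - g s₀) ≤ 0 := fun u _ =>
      mul_nonpos_of_nonneg_of_nonpos
        (mul_nonneg (invMeasure back s.1).2.le (moveRate_nonneg _ _ _))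
        (sub_nonpos.2 (hs₀ u))
    have h := (Finset.sum_eq_zero_iff_of_nonpos hle).1 hsum t (Finset.mem_univ t)
    rcases mul_eq_zero.1 h with h | h
    · exact absurd h (mul_pos (invMeasure back s.1).2 hl.moveRate_pos).ne'
    · exact sub_eq_zero.1 h
  refine ⟨g s₀, fun t => ?_⟩
  rw [hg t]
  congr 1
  obtain ⟨t, ht⟩ := t
  have hpath := reflTransGen_of_mem_states s₀.2 ht
  induction hpath with
  | refl => rfl
  | @tail u v huv h ih =>
    have hu : u ∈ States back R := Relation.ReflTransGen.trans s₀.2 huv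
    exact hstep ⟨u, hu⟩ ⟨v, ht⟩ (ih hu) h

/-- The steady-state distribution is the normalized invariant measure. -/
theorem isSteadyState_iff [Fintype (States back R)] (π : States back R → ℝ) :
    IsSteadyState back R π ↔ π = fun s =>
      (invMeasure back s.1 : ℝ) / ∑ t : States back R, (invMeasure back t.1 : ℝ) := by
  have : Nonempty (States back R) := ⟨⟨cls R, .refl⟩⟩
  have hZ : (0 : ℝ) < ∑ t : States back R, (invMeasure back t.1 : ℝ) :=
    Finset.sum_pos (fun t _ => (invMeasure back t.1).2) Finset.univ_nonempty
  constructor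
  · rintro ⟨-, h₁, h₂⟩
    obtain ⟨c, hc⟩ := exists_eq_mul_invMeasure fun s' => (hasSum_fintype _).unique (h₂ s')
    have h := (hasSum_fintype π).unique h₁
    simp only [hc, ← Finset.mul_sum] at h
    funext s
    rw [hc, eq_div_iff hZ.ne', mul_right_comm, h, one_mul]
  · rintro rfl
    refine ⟨fun s => div_pos (invMeasure back s.1).2 hZ, ?_, fun s' => ?_⟩
    · convert hasSum_fintype _ using 1
      rw [← Finset.sum_div, div_self hZ.ne']
    · convert hasSum_fintype _ using 1
      rw [sum_mul_generator]
      refine (Finset.sum_eq_zero fun s _ => ?_).symm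
      rw [div_mul_eq_mul_div, div_mul_eq_mul_div, invMeasure_mul_moveRate, sub_self]

theorem existsUnique_isSteadyState [Infinite Key] (back : Act → Rate → Rate)
    (R : ReachableProc Act Key) : ∃! π, IsSteadyState back R π := by
  have := (finite_states back R).fintype
  simp only [isSteadyState_iff]
  exact existsUnique_eq

end SteadyState

/-! ### Compound states and their components -/

section Compound

open Proc

variable {back : Act → Rate → Rate} {L : Set Act}

theorem IsCompound.invMeasure_eq {s s₁ s₂ : KClass Act Key} (h : IsCompound L s s₁ s₂) :
    invMeasure back s = invMeasure back s₁ * invMeasure back s₂ := by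
  obtain ⟨S, S₁, S₂, hS, rfl, rfl, rfl⟩ := h
  simp only [invMeasure, clsWeight_cls, hS, weight, mul_div_mul_comm]

/-- A permutation of keys relating two parallel compositions acts on each component. -/
theorem IsCompound.unique {s s₁ s₂ t₁ t₂ : KClass Act Key} [Infinite Key]
    (h : IsCompound L s s₁ s₂) (h' : IsCompound L s t₁ t₂) : s₁ = t₁ ∧ s₂ = t₂ := by
  obtain ⟨S, S₁, S₂, hS, rfl, rfl, rfl⟩ := h
  obtain ⟨T, T₁, T₂, hT, hTS, rfl, rfl⟩ := h'
  obtain ⟨σ, hσ⟩ := exists_perm_of_cls_eq hTS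
  rw [hS, hT] at hσ
  simp only [mapKeys, par.injEq, true_and] at hσ
  constructor
  · rw [← cls_mapKeys (R := T₁) σ.injective.injOn]
    exact congrArg cls (Subtype.ext hσ.1)
  · rw [← cls_mapKeys (R := T₂) σ.injective.injOn]
    exact congrArg cls (Subtype.ext hσ.2)

theorem exists_isCompound {R₁ R₂ : Proc Act Key} {hR : (par R₁ L R₂).Reachable}
    {s : KClass Act Key} (hs : s ∈ States back ⟨par R₁ L R₂, hR⟩) :
    ∃ s₁ s₂, IsCompound L s s₁ s₂ := by
  obtain ⟨⟨S, hS⟩, rfl⟩ := cls_surjective s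
  have h := clsSkeleton_of_mem_states hs
  rw [clsSkeleton_cls] at h
  cases S <;> simp only [skeleton, reduceCtorEq, par.injEq] at h
  obtain ⟨-, rfl, -⟩ := h
  exact ⟨_, _, _, ⟨_, hS.par_inv.1⟩, ⟨_, hS.par_inv.2.1⟩, rfl, rfl, rfl, rfl⟩

/-- The standard origin of `R` lies in its chain because all steps can be undone. -/
theorem exists_std_mem_states (back : Act → Rate → Rate) (R : ReachableProc Act Key) :
    ∃ P : ReachableProc Act Key, P.1.Std ∧ cls P ∈ States back R := by
  obtain ⟨R, hR⟩ := R
  obtain ⟨P, hP, h⟩ := id hR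
  refine ⟨⟨P, P, hP, .refl⟩, hP, ?_⟩
  refine reflTransGen_ktrans_symm ?_
  induction h with
  | refl => exact .refl
  | @tail S T hS h ih =>
    obtain ⟨a, r, i, h⟩ := h
    have hS' : S.Reachable := ⟨P, hP, hS⟩
    exact (ih hS').tail ⟨(a, r), Or.inl ⟨⟨S, hS'⟩, ⟨T, hR⟩, i, rfl, rfl, h⟩⟩

/-- An executed synchronizing action on the left needs a partner with the same key on the right,
where a standard term has none. -/
theorem IsCompound.disjoint_clsActs_left {s s₁ : KClass Act Key} {P : ReachableProc Act Key}
    (hP : P.1.Std) (h : IsCompound L s s₁ (cls P)) : Disjoint L (clsActs s₁) := by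
  obtain ⟨⟨_, hS⟩, S₁, S₂, rfl, -, rfl, h₂⟩ := h
  obtain ⟨σ, hσ⟩ := exists_perm_of_cls_eq h₂.symm
  rw [Set.disjoint_left]
  intro a ha haS
  rw [clsActs_cls] at haS
  obtain ⟨⟨b, i⟩, hb, rfl⟩ := haS
  have := (hS.par_inv.2.2.1 b ha i).1 hb
  rw [hσ, (hP.mapKeys σ).pasts_eq_empty] at this
  exact this

theorem Reachable.disjoint_keys_of_par {R S : Proc Act Key} (h : (par R L S).Reachable)
    (hL : Disjoint L (Prod.fst '' R.pasts)) : Disjoint R.keys S.keys := by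
  rw [Set.disjoint_left]
  intro i hi hi'
  obtain ⟨a, ha, hai⟩ := h.par_inv.2.2.2 i hi hi'
  exact Set.disjoint_left.1 hL ha ⟨_, hai, rfl⟩

/-- In the absence of executed synchronizing actions, a compound state is determined by its
components. -/
theorem IsCompound.eq_of_disjoint [Infinite Key] {s t s₁ s₂ : KClass Act Key}
    (hL : Disjoint L (clsActs s₁)) (h : IsCompound L s s₁ s₂) (h' : IsCompound L t s₁ s₂) :
    s = t := by
  classical
  obtain ⟨⟨_, hS⟩, S₁, S₂, rfl, rfl, rfl, rfl⟩ := h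
  obtain ⟨⟨_, hT⟩, T₁, T₂, rfl, rfl, h₁, h₂⟩ := h'
  obtain ⟨σ, hσ⟩ := exists_perm_of_cls_eq h₁.symm
  obtain ⟨τ, hτ⟩ := exists_perm_of_cls_eq h₂.symm
  have hdS : Disjoint S₁.1.keys S₂.1.keys :=
    Reachable.disjoint_keys_of_par hS (clsActs_cls S₁ ▸ hL)
  have hdT : Disjoint T₁.1.keys T₂.1.keys :=
    Reachable.disjoint_keys_of_par hT (by rwa [← clsActs_cls, h₁])
  rw [hσ, hτ, keys_mapKeys, keys_mapKeys] at hdT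
  -- Since the key sets are disjoint, `σ` and `τ` glue to one renaming of the whole composition;
  -- disjointness on the `T` side makes it injective.
  have e₁ : Set.EqOn (S₁.1.keys.piecewise σ τ) σ S₁.1.keys := Set.piecewise_eqOn _ _ _
  have e₂ : Set.EqOn (S₁.1.keys.piecewise σ τ) τ S₂.1.keys := fun i hi =>
    Set.piecewise_eq_of_notMem _ _ _ fun h => Set.disjoint_left.1 hdS h hi
  have hinj : Set.InjOn (S₁.1.keys.piecewise σ τ) (S₁.1.keys ∪ S₂.1.keys) := by
    rw [Set.injOn_union hdS]
    refine ⟨σ.injective.injOn.congr e₁.symm, τ.injective.injOn.congr e₂.symm, ?_⟩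
    intro i hi j hj h
    rw [e₁ hi, e₂ hj] at h
    exact Set.disjoint_left.1 hdT ⟨i, hi, h⟩ ⟨j, hj, rfl⟩
  rw [← cls_mapKeys (R := ⟨par S₁.1 L S₂.1, hS⟩) (f := S₁.1.keys.piecewise σ τ) hinj]
  refine congrArg cls (Subtype.ext ?_)
  simp only [mapKeys]
  rw [mapKeys_congr e₁, mapKeys_congr e₂, hσ, hτ]

end Compound

end RMPC

theorem mainTheorem8 {Act Key : Type*} [Countable Act] [Countable Key] [Infinite Key]
    (back : Act → RMPC.Rate → RMPC.Rate)
    (R₁ R₂ : RMPC.ReachableProc Act Key) (L : Set Act)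
    (hR : (RMPC.Proc.par R₁.1 L R₂.1).Reachable)
    (hrev : (∀ a r, back a r = r) ∨ (R₁.1.ParFree ∧ R₂.1.ParFree))
    (hprod : {p : RMPC.KClass Act Key × RMPC.KClass Act Key |
        ∃ s ∈ RMPC.States back ⟨RMPC.Proc.par R₁.1 L R₂.1, hR⟩, RMPC.IsCompound L s p.1 p.2} =
      RMPC.States back R₁ ×ˢ RMPC.States back R₂) :
    (∃! π₁, RMPC.IsSteadyState back R₁ π₁) ∧
    (∃! π₂, RMPC.IsSteadyState back R₂ π₂) ∧
    (∃! π, RMPC.IsSteadyState back ⟨RMPC.Proc.par R₁.1 L R₂.1, hR⟩ π) ∧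
    ∀ π₁ π₂ π, RMPC.IsSteadyState back R₁ π₁ → RMPC.IsSteadyState back R₂ π₂ →
      RMPC.IsSteadyState back ⟨RMPC.Proc.par R₁.1 L R₂.1, hR⟩ π →
      ∀ (s₁ : RMPC.States back R₁) (s₂ : RMPC.States back R₂)
        (s : RMPC.States back ⟨RMPC.Proc.par R₁.1 L R₂.1, hR⟩),
        RMPC.IsCompound L s.1 s₁.1 s₂.1 → π s = π₁ s₁ * π₂ s₂ := by
  refine ⟨RMPC.existsUnique_isSteadyState _ _, RMPC.existsUnique_isSteadyState _ _,
    RMPC.existsUnique_isSteadyState _ _, ?_⟩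
  have := (RMPC.finite_states back R₁).fintype
  have := (RMPC.finite_states back R₂).fintype
  have := (RMPC.finite_states back ⟨RMPC.Proc.par R₁.1 L R₂.1, hR⟩).fintype
  intro π₁ π₂ π h₁ h₂ h s₁ s₂ s hs
  rw [RMPC.isSteadyState_iff] at h₁ h₂ h
  subst h₁ h₂ h
  have hcompound (p : RMPC.States back R₁ × RMPC.States back R₂) :
      ∃ s : RMPC.States back ⟨RMPC.Proc.par R₁.1 L R₂.1, hR⟩,
        RMPC.IsCompound L s.1 p.1.1 p.2.1 := by
    have hp : (p.1.1, p.2.1) ∈ RMPC.States back R₁ ×ˢ RMPC.States back R₂ := ⟨p.1.2, p.2.2⟩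
    rw [← hprod] at hp
    obtain ⟨s, hs, h⟩ := hp
    exact ⟨⟨s, hs⟩, h⟩
  choose f hf using hcompound
  -- Pairing every left state with this standard right state excludes executed synchronizing actions
  -- on the left.
  obtain ⟨P, hP, hPmem⟩ := RMPC.exists_std_mem_states back R₂
  have hL (s₁ : RMPC.States back R₁) : Disjoint L (RMPC.clsActs s₁.1) :=
    (hf (s₁, ⟨RMPC.cls P, hPmem⟩)).disjoint_clsActs_left hP
  have hbij : Function.Bijective f := by
    constructor
    · intro p q hpq
      have hq := hf q
      rw [← hpq] at hq
      obtain ⟨h₁, h₂⟩ := (hf p).unique hq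
      exact Prod.ext (Subtype.ext h₁) (Subtype.ext h₂)
    · intro s
      obtain ⟨t₁, t₂, ht⟩ := RMPC.exists_isCompound s.2
      have hmem : (t₁, t₂) ∈ RMPC.States back R₁ ×ˢ RMPC.States back R₂ :=
        hprod ▸ ⟨s.1, s.2, ht⟩
      exact ⟨(⟨t₁, hmem.1⟩, ⟨t₂, hmem.2⟩), Subtype.ext
        ((hf (⟨t₁, hmem.1⟩, ⟨t₂, hmem.2⟩)).eq_of_disjoint (hL ⟨t₁, hmem.1⟩) ht)⟩
  -- The normalizing constant factors, by summing the multiplicative measure over pairs.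
  have hsum : ∑ t : RMPC.States back ⟨RMPC.Proc.par R₁.1 L R₂.1, hR⟩,
      (RMPC.invMeasure back t.1 : ℝ) =
      (∑ t : RMPC.States back R₁, (RMPC.invMeasure back t.1 : ℝ)) *
        ∑ t : RMPC.States back R₂, (RMPC.invMeasure back t.1 : ℝ) := by
    rw [Fintype.sum_mul_sum, ← Fintype.sum_prod_type', ← hbij.sum_comp]
    exact Finset.sum_congr rfl fun p _ => by rw [(hf p).invMeasure_eq, Positive.val_mul]
  simp only [hsum, hs.invMeasure_eq, Positive.val_mul, mul_div_mul_comm]
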